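/- **Setting.** Let $\mathcal K\subseteq\mathbb R^n$ be nonempty, closed and convex, let $U,g_1,\dots,g_m:\mathcal K\to\mathbb R$, and consider the nonconvex problem $$(\mathcal P)\qquad \min_{x}\ U(x)\quad\text{s.t. } x\in\mathcal X:=\{x\in\mathcal K:\ g_j(x)\le 0,\ j=1,\dots,m\}.$$ Let $N_{\mathcal K}(x)=\{d\in\mathbb R^n: d^T(y-x)\le 0\ \ \forall y\in\mathcal K\}$ be the normal cone and $J(x)=\{j: g_j(x)=0\}$. A point $\bar x\in\mathcal X$ is *stationary* for $(\mathcal P)$ if there are $\mu_j\ge0$, $j\in J(\bar x)$, with $0\in\nabla U(\bar x)+\sum_{j\in J(\bar x)}\mu_j\nabla g_j(\bar x)+N_{\mathcal K}(\bar x)$. It is *regular* (MFCQ) if $0\in\sum_{j\in J(\bar x)}\mu_j\nabla g_j(\bar x)+N_{\mathcal K}(\bar x)$ with all $\mu_j\ge0$ implies that all $\mu_j=0$. Let $\tilde U,\tilde g_1,\dots,\tilde g_m:\mathcal K\times\mathcal X\to\mathbb R$ be differentiable in the first argument, with partial gradients $\nabla_x\tilde U,\nabla_x\tilde g_j$, and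 put $\mathcal X(y)=\{x\in\mathcal K:\tilde g_j(x;y)\le0,\ j=1,\dots,m\}$ for $y\in\mathcal X$. **Assumption 1.** $U$ and the $g_j$ are continuously differentiable on $\mathcal K$; $\nabla U$ is Lipschitz on $\mathcal K$ with constant $L_{\nabla U}$; $U$ is coercive on $\mathcal K$, that is, $U(x)\to+\infty$ as $\|x\|\to\infty$, $x\in\mathcal K$. **Assumption 2.** There is a constant $c_{\tilde U}>0$ with $(x-z)^T(\nabla_x\tilde U(x;y)-\nabla_x\tilde U(z;y))\ge c_{\tilde U}\|x-z\|^2$ for all $x,z\in\mathcal K$, $y\in\mathcal X$; $\nabla_x\tilde U(y;y)=\nabla U(y)$ for all $y\in\mathcal X$; $\nabla_x\tilde U$ is continuous on $\mathcal K\times\mathcal X$. **Assumption 3.** For every $j$: $\tilde g_j(\cdot\,;y)$ is convex on $\mathcal K$ for all $y\in\mathcal X$; $\tilde g_j(y;y)=g_j(y)$ and $\nabla_x\tilde g_j(y;y)=\nabla g_j(y)$ for all $y\in\mathcal X$; $g_j(x)\le\tilde g_j(x;y)$ for all $x\in\mathcal K$, $y\in\mathcal X$; $\tilde g_j$ and $\nabla_x\tilde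 g_j$ are continuous on $\mathcal K\times\mathcal X$. **Assumption 4.** $\nabla_x\tilde U(x;\cdot)$ is Lipschitz on $\mathcal X$ uniformly in $x\in\mathcal K$, $\nabla_x\tilde U(\cdot\,;y)$ is Lipschitz on $\mathcal K$ uniformly in $y\in\mathcal X$, and every $\tilde g_j$ is Lipschitz on $\mathcal K\times\mathcal X$. **Assumption 5.** Every point of $\mathcal X$ is regular. **Algorithm (NOVA).** Given $\gamma^\nu\in(0,1]$ and $x^0\in\mathcal X$, for $\nu=0,1,2,\dots$: if $x^\nu$ is stationary for $(\mathcal P)$, stop; otherwise let $\hat x(x^\nu)$ be the minimizer of $\tilde U(\cdot\,;x^\nu)$ over $\mathcal X(x^\nu)$ and set $x^{\nu+1}=x^\nu+\gamma^\nu(\hat x(x^\nu)-x^\nu)$. (If the algorithm stops, the last iterate is repeated forever.) **Theorem.** Let Assumptions 1, 2, 3 and 5 hold and let $\{x^\nu\}$ be a sequence generated by the algorithm. (a) $x^\nu\in\mathcal X(x^\nu)\subseteq\mathcal X$ for all $\nu\ge0$. (b) If $0<\inf_\nu\gamma^\nu\le\sup_\nu\gamma^\nu\le\gamma^{\max}\le1$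 and $2c_{\tilde U}>\gamma^{\max}L_{\nabla U}$, then $\{x^\nu\}$ is bounded and each of its limit points is stationary for $(\mathcal P)$. (c) If $\gamma^\nu\to0$ and $\sum_\nu\gamma^\nu=+\infty$, then $\{x^\nu\}$ is bounded and at least one of its limit points is stationary for $(\mathcal P)$. If, in addition, Assumption 4 holds and $\mathcal X$ is compact, every limit point of $\{x^\nu\}$ is stationary for $(\mathcal P)$. Furthermore, in (b) and in (c), if the algorithm does not stop after finitely many steps, no limit point of $\{x^\nu\}$ is a local maximum of $U$ on $\mathcal X$ (hence none is a local maximum of $U$ on $\mathcal K$). -/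

import Mathlib

open Set Filter Topology
open scoped NNReal

namespace NOVA

/-- Data of the problem: minimize `U x` subject to `g j x ≤ 0` (`j = 1, …, m`) and `x ∈ K`.
The functions only matter on `K`. The fields `gradU`, `gradg` are the gradients of `U` and of the
`g j` on `K`; they are tied to `U` and `g j` in `Assumption1`. (They are carried along because `K`
may have empty interior, where a gradient relative to `K` is not unique.) -/
structure Problem (n m : ℕ) where
  K : Set (EuclideanSpace ℝ (Fin n))
  U : EuclideanSpace ℝ (Fin n) → ℝ
  gradU : EuclideanSpace ℝ (Fin n) → EuclideanSpace ℝ (Fin n)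
  g : Fin m → EuclideanSpace ℝ (Fin n) → ℝ
  gradg : Fin m → EuclideanSpace ℝ (Fin n) → EuclideanSpace ℝ (Fin n)

/-- Data of the approximations: `Ut x y` is `Ũ(x; y)`, `gt j x y` is `g̃ⱼ(x; y)`, and `gradUt x y`,
`gradgt j x y` are their partial gradients with respect to the first argument `x`; the gradients
are tied to the functions in `Assumption2` and `Assumption3`. Only the values for `x ∈ K` and
feasible `y` matter. -/
structure Approx (n m : ℕ) where
  Ut : EuclideanSpace ℝ (Fin n) → EuclideanSpace ℝ (Fin n) → ℝ
  gradUt : EuclideanSpace ℝ (Fin n) → EuclideanSpace ℝ (Fin n) → EuclideanSpace ℝ (Fin n)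
  gt : Fin m → EuclideanSpace ℝ (Fin n) → EuclideanSpace ℝ (Fin n) → ℝ
  gradgt : Fin m → EuclideanSpace ℝ (Fin n) → EuclideanSpace ℝ (Fin n) →
    EuclideanSpace ℝ (Fin n)

variable {n m : ℕ}

/-- The feasible set `𝒳`. -/
def Problem.feasible (P : Problem n m) : Set (EuclideanSpace ℝ (Fin n)) :=
  {x | x ∈ P.K ∧ ∀ j, P.g j x ≤ 0}

/-- The feasible set `𝒳(y)` of the convex subproblem at `y`. -/
def Approx.feasibleAt (A : Approx n m) (P : Problem n m) (y : EuclideanSpace ℝ (Fin n)) :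
    Set (EuclideanSpace ℝ (Fin n)) :=
  {x | x ∈ P.K ∧ ∀ j, A.gt j x y ≤ 0}

/-- The normal cone to `K` at `x`. -/
def normalCone (K : Set (EuclideanSpace ℝ (Fin n))) (x : EuclideanSpace ℝ (Fin n)) :
    Set (EuclideanSpace ℝ (Fin n)) :=
  {d | ∀ y ∈ K, inner ℝ d (y - x) ≤ 0}

/-- Regularity (Mangasarian-Fromovitz constraint qualification) at a feasible point. The
multipliers of the inactive constraints are set to zero. -/
def Problem.IsRegular (P : Problem n m) (x : EuclideanSpace ℝ (Fin n)) : Prop :=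
  x ∈ P.feasible ∧ ∀ μ : Fin m → ℝ, (∀ j, 0 ≤ μ j) → (∀ j, P.g j x ≠ 0 → μ j = 0) →
    -(∑ j, μ j • P.gradg j x) ∈ normalCone P.K x → ∀ j, μ j = 0

/-- Stationary (KKT) points of the nonconvex problem. -/
def Problem.IsStationary (P : Problem n m) (x : EuclideanSpace ℝ (Fin n)) : Prop :=
  x ∈ P.feasible ∧ ∃ μ : Fin m → ℝ, (∀ j, 0 ≤ μ j) ∧ (∀ j, P.g j x ≠ 0 → μ j = 0) ∧
    -(P.gradU x + ∑ j, μ j • P.gradg j x) ∈ normalCone P.K x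

/-- Blanket assumptions on the problem; `L` is the Lipschitz constant of `∇U` on `K`. -/
structure Assumption1 (P : Problem n m) (L : ℝ≥0) : Prop where
  closed : IsClosed P.K
  convex : Convex ℝ P.K
  nonempty : P.K.Nonempty
  hasGradU : ∀ x ∈ P.K, HasGradientWithinAt P.U (P.gradU x) P.K x
  contGradU : ContinuousOn P.gradU P.K
  hasGradg : ∀ j, ∀ x ∈ P.K, HasGradientWithinAt (P.g j) (P.gradg j x) P.K x
  contGradg : ∀ j, ContinuousOn (P.gradg j) P.K
  lipschitz : LipschitzOnWith L P.gradU P.K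
  coercive : Tendsto P.U (Bornology.cobounded (EuclideanSpace ℝ (Fin n)) ⊓ 𝓟 P.K) atTop

/-- Assumptions on `Ũ`; `c` is the constant of uniform strong convexity. Continuity of the gradient
in the first argument is part of B3. -/
structure Assumption2 (P : Problem n m) (A : Approx n m) (c : ℝ) : Prop where
  hasGrad : ∀ y ∈ P.feasible, ∀ x ∈ P.K,
    HasGradientWithinAt (fun z => A.Ut z y) (A.gradUt x y) P.K x
  c_pos : 0 < c
  B1 : ∀ x ∈ P.K, ∀ z ∈ P.K, ∀ y ∈ P.feasible,
    c * ‖x - z‖ ^ 2 ≤ inner ℝ (x - z) (A.gradUt x y - A.gradUt z y)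
  B2 : ∀ y ∈ P.feasible, A.gradUt y y = P.gradU y
  B3 : ContinuousOn (fun p : EuclideanSpace ℝ (Fin n) × EuclideanSpace ℝ (Fin n) =>
    A.gradUt p.1 p.2) (P.K ×ˢ P.feasible)

/-- Assumptions on the `g̃ⱼ`. -/
structure Assumption3 (P : Problem n m) (A : Approx n m) : Prop where
  hasGrad : ∀ j, ∀ y ∈ P.feasible, ∀ x ∈ P.K,
    HasGradientWithinAt (fun z => A.gt j z y) (A.gradgt j x y) P.K x
  C1 : ∀ j, ∀ y ∈ P.feasible, ConvexOn ℝ P.K (fun x => A.gt j x y)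
  C2 : ∀ j, ∀ y ∈ P.feasible, A.gt j y y = P.g j y
  C3 : ∀ j, ∀ x ∈ P.K, ∀ y ∈ P.feasible, P.g j x ≤ A.gt j x y
  C4 : ∀ j, ContinuousOn (fun p : EuclideanSpace ℝ (Fin n) × EuclideanSpace ℝ (Fin n) =>
    A.gt j p.1 p.2) (P.K ×ˢ P.feasible)
  C5 : ∀ j, ∀ y ∈ P.feasible, P.gradg j y = A.gradgt j y y
  C6 : ∀ j, ContinuousOn (fun p : EuclideanSpace ℝ (Fin n) × EuclideanSpace ℝ (Fin n) =>
    A.gradgt j p.1 p.2) (P.K ×ˢ P.feasible)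

/-- The additional Lipschitz assumptions on the approximations. -/
structure Assumption4 (P : Problem n m) (A : Approx n m) : Prop where
  B4 : ∃ L₂ : ℝ≥0, ∀ x ∈ P.K, LipschitzOnWith L₂ (fun y => A.gradUt x y) P.feasible
  B5 : ∃ L₁ : ℝ≥0, ∀ y ∈ P.feasible, LipschitzOnWith L₁ (fun x => A.gradUt x y) P.K
  C7 : ∀ j, ∃ L : ℝ≥0, LipschitzOnWith L
    (fun p : EuclideanSpace ℝ (Fin n) × EuclideanSpace ℝ (Fin n) => A.gt j p.1 p.2)
    (P.K ×ˢ P.feasible)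

/-- Every feasible point is regular. -/
def Assumption5 (P : Problem n m) : Prop :=
  ∀ x ∈ P.feasible, P.IsRegular x

/-- `z` is the solution `x̂(y)` of the subproblem at `y`: it minimizes `Ũ(•; y)` over `𝒳(y)`. -/
def IsBestResponse (P : Problem n m) (A : Approx n m) (y z : EuclideanSpace ℝ (Fin n)) : Prop :=
  z ∈ A.feasibleAt P y ∧ ∀ w ∈ A.feasibleAt P y, A.Ut z y ≤ A.Ut w y

/-- `x` is the sequence generated by the NOVA algorithm with step sizes `γ`. If the algorithm stops
(at a stationary iterate), the last iterate is repeated forever. -/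
structure IsNOVASequence (P : Problem n m) (A : Approx n m) (γ : ℕ → ℝ)
    (x : ℕ → EuclideanSpace ℝ (Fin n)) : Prop where
  stepSize : ∀ ν, 0 < γ ν ∧ γ ν ≤ 1
  init : x 0 ∈ P.feasible
  stopped : ∀ ν, P.IsStationary (x ν) → x (ν + 1) = x ν
  step : ∀ ν, ¬ P.IsStationary (x ν) →
    ∃ xhat, IsBestResponse P A (x ν) xhat ∧ x (ν + 1) = x ν + γ ν • (xhat - x ν)

end NOVA

/-! ### Convex analysis along segments and separation. -/

section Hilbert

variable {F : Type*} [NormedAddCommGroup F] [InnerProductSpace ℝ F]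

/-! Write `d ν` for the best response minus the iterate. Strong monotonicity of the model gradient
and the descent lemma give, once `c - γ ν * L / 2 ≥ η`, a decrease of `U` by at least `η * γ ν * ‖d
ν‖ ^ 2`; coercivity then yields boundedness and convergence of `U (x ν)`.

The key is `exists_le_dist_bestResponse`: near a regular nonstationary point, `‖d ν‖ ≥ ε`. Otherwise
a direction that strictly decreases the objective and all active constraints, supplied by a theorem
of the alternative, would violate optimality of the best response. No continuity of the
best-response map is involved.

If a limit point were nonstationary, one factor `‖d ν‖` could be replaced by `ε`, so the decrease of
`U` would bound the path length near it. An iterate close enough to it, with `U` close enough to its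
limit, would trap all later ones, and `∑ γ ν` would be finite. Both step-size rules reduce to this
argument, carried out in `limit_behaviour_of_not_stationary`. -/

theorem Convex.mapsTo_line {K : Set F} (hK : Convex ℝ K) {x y : F} (hx : x ∈ K) (hy : y ∈ K) :
    MapsTo (fun t : ℝ => x + t • (y - x)) (Icc 0 1) K :=
  fun _ ht => hK.add_smul_sub_mem hx hy ht

/-- Theorem of the alternative: finitely many linear functionals have a common strict descent
direction into a convex set, or a nontrivial nonnegative combination of them is nonnegative on the
set. -/
theorem exists_inner_neg_or_exists_multipliers {ι : Type*} [Fintype ι] {K : Set F}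
    (hK : Convex ℝ K) {x : F} (hx : x ∈ K) (a : ι → F) :
    (∃ w ∈ K, ∀ i, inner ℝ (a i) (w - x) < 0) ∨
      ∃ l : ι → ℝ, (∀ i, 0 ≤ l i) ∧ (∃ i, l i ≠ 0) ∧
        ∀ w ∈ K, inner ℝ (-∑ i, l i • a i) (w - x) ≤ 0 := by
  classical
  by_cases hex : ∃ w ∈ K, ∀ i, inner ℝ (a i) (w - x) < 0
  · exact Or.inl hex
  right
  let T : Set (ι → ℝ) := {v | ∀ i, v i < 0}
  let S : Set (ι → ℝ) := (fun w => fun i => inner ℝ (a i) (w - x)) '' K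
  have hT : Convex ℝ T := by
    have : T = univ.pi fun _ => Iio 0 := by ext; simp [T]
    rw [this]
    exact convex_pi fun _ _ => convex_Iio 0
  have hTo : IsOpen T := by
    have : T = univ.pi fun _ => Iio 0 := by ext; simp [T]
    rw [this]
    exact isOpen_set_pi finite_univ fun _ _ => isOpen_Iio
  have hS : Convex ℝ S := by
    rintro _ ⟨w, hw, rfl⟩ _ ⟨w', hw', rfl⟩ p q hp hq hpq
    refine ⟨p • w + q • w', hK hw hw' hp hq hpq, ?_⟩
    funext i
    have : p • w + q • w' - x = p • (w - x) + q • (w' - x) := by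
      rw [smul_sub, smul_sub, sub_add_sub_comm, ← add_smul, hpq, one_smul]
    simp [this, inner_add_right, inner_smul_right]
  have hdisj : Disjoint T S := by
    rw [Set.disjoint_left]
    rintro _ hv ⟨w, hw, rfl⟩
    exact hex ⟨w, hw, hv⟩
  -- The multipliers are the coordinates of a functional separating the open negative orthant from
  -- the image of `K`. The threshold `u` is `0`: the image contains `0`, and `0` is a limit of
  -- points of the orthant.
  obtain ⟨f, u, hfT, hfS⟩ := geometric_hahn_banach_open hT hTo hS hdisj
  have hu0 : u ≤ 0 := by
    have := hfS _ ⟨x, hx, rfl⟩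
    simpa [← Pi.zero_def] using this
  have hone : (fun _ : ι => (-1 : ℝ)) ∈ T := fun _ => by norm_num
  have hneg : ∀ v ∈ T, f v < 0 := fun v hv => (hfT v hv).trans_le hu0
  have hu : 0 ≤ u := by
    refine le_of_forall_pos_lt_add fun ε hε => ?_
    have h1 := hneg _ hone
    set r := f fun _ : ι => (-1 : ℝ)
    have h2 := hfT ((ε / (-r)) • fun _ : ι => (-1 : ℝ)) fun i => by
      have : 0 < ε / (-r) := div_pos hε (by linarith)
      simpa using this
    rw [map_smul, smul_eq_mul] at h2
    have : ε / -r * r = -ε := by field_simp [h1.ne]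
    linarith
  have hrep : ∀ v : ι → ℝ, f v = ∑ i, v i * f (Pi.single i 1) := by
    intro v
    conv_lhs => rw [← Finset.univ_sum_single v]
    rw [map_sum]
    refine Finset.sum_congr rfl fun i _ => ?_
    rw [← smul_eq_mul, ← map_smul, ← Pi.single_smul, smul_eq_mul, mul_one]
  refine ⟨fun i => f (Pi.single i 1), fun i => ?_, ?_, fun w hw => ?_⟩
  · by_contra! hi
    have h1 := hneg _ hone
    set r := f fun _ : ι => (-1 : ℝ)
    set s := f (Pi.single i 1)
    -- If the `i`-th coefficient `s` were negative, pushing that coordinate further down by `r / s`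
    -- would stay in the orthant but bring `f` up to exactly `0`.
    have h2 := hneg ((r / s) • (-Pi.single i 1) + fun _ : ι => (-1 : ℝ)) fun k => by
      have : 0 < r / s := div_pos_of_neg_of_neg h1 hi
      by_cases hk : k = i
      · subst hk; simp; linarith
      · simp [hk]
    rw [map_add, map_smul, map_neg, smul_eq_mul] at h2
    have : r / s * -s = -r := by field_simp [hi.ne]
    change r / s * -s + r < 0 at h2
    linarith
  · by_contra! h
    have := hneg _ hone
    rw [hrep] at this
    simp [h] at this
  · have h := hu.trans (hfS _ ⟨w, hw, rfl⟩)
    rw [hrep] at h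
    rw [inner_neg_left, sum_inner, neg_nonpos]
    refine h.trans_eq (Finset.sum_congr rfl fun i _ => ?_)
    rw [real_inner_smul_left, mul_comm]

variable [CompleteSpace F]

theorem HasGradientWithinAt.hasDerivWithinAt_line {f : F → ℝ} {a x v : F} {K : Set F} {s : Set ℝ}
    {t : ℝ} (hf : HasGradientWithinAt f a K (x + t • v))
    (hs : MapsTo (fun t : ℝ => x + t • v) s K) :
    HasDerivWithinAt (fun t : ℝ => f (x + t • v)) (inner ℝ a v) s t := by
  have h1 : HasDerivWithinAt (fun t : ℝ => x + t • v) v s t := by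
    simpa using ((hasDerivWithinAt_id t s).smul_const v).const_add x
  simpa [Function.comp_def] using hf.hasFDerivWithinAt.comp_hasDerivWithinAt t h1 hs

/-- Along a segment of strict descent directions a nonpositive function becomes negative; if the
function is already negative, the direction is arbitrary. -/
theorem eventually_neg_of_hasGradientWithinAt {f : F → ℝ} {a x y : F} {K : Set F}
    (hK : Convex ℝ K) (hx : x ∈ K) (hy : y ∈ K) (hf : HasGradientWithinAt f a K x)
    (h0 : f x ≤ 0) (hdesc : f x = 0 → inner ℝ a (y - x) < 0) :
    ∀ᶠ t : ℝ in 𝓝[>] 0, f (x + t • (y - x)) < 0 := by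
  have hmaps : MapsTo (fun t : ℝ => x + t • (y - x)) (Ioc 0 1) K :=
    (hK.mapsTo_line hx hy).mono_left Ioc_subset_Icc_self
  have hd : HasDerivWithinAt (fun t : ℝ => f (x + t • (y - x))) (inner ℝ a (y - x)) (Ioc 0 1) 0 :=
    HasGradientWithinAt.hasDerivWithinAt_line (by simpa using hf) hmaps
  rw [← nhdsWithin_Ioc_eq_nhdsGT (zero_lt_one' ℝ)]
  rcases h0.lt_or_eq with h | h
  · exact hd.continuousWithinAt.eventually_lt continuousWithinAt_const (by simpa using h)
  · have ht := (hasDerivWithinAt_iff_tendsto_slope' (by simp)).1 hd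
    filter_upwards [ht.eventually (gt_mem_nhds (hdesc h)), self_mem_nhdsWithin] with t hlt ht0
    have : 0 < t := ht0.1
    simp only [slope_def_field, zero_smul, add_zero, sub_zero, h] at hlt
    rwa [div_lt_iff₀ this, zero_mul] at hlt

/-- Along the segment, `f` minus its quadratic model is antitone: its derivative is nonpositive by
Cauchy-Schwarz and the Lipschitz bound. Only gradients relative to `K` enter, so `K` may have empty
interior. -/
theorem le_add_inner_add_of_lipschitzOnWith_gradient {f : F → ℝ} {f' : F → F} {K : Set F}
    {L : ℝ≥0} (hK : Convex ℝ K) (hf : ∀ x ∈ K, HasGradientWithinAt f (f' x) K x)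
    (hL : LipschitzOnWith L f' K) {x y : F} (hx : x ∈ K) (hy : y ∈ K) :
    f y ≤ f x + inner ℝ (f' x) (y - x) + L / 2 * ‖y - x‖ ^ 2 := by
  set v := y - x with hv
  have hmaps := hK.mapsTo_line hx hy
  have hderiv : ∀ t ∈ Icc (0 : ℝ) 1, HasDerivWithinAt
      (fun t : ℝ => f (x + t • v) - (t * inner ℝ (f' x) v + L / 2 * ‖v‖ ^ 2 * t ^ 2))
      (inner ℝ (f' (x + t • v)) v - (inner ℝ (f' x) v + L * t * ‖v‖ ^ 2)) (Icc 0 1) t := by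
    intro t ht
    have h1 := (hf _ (hmaps ht)).hasDerivWithinAt_line hmaps
    have h2 := ((hasDerivWithinAt_id t (Icc (0 : ℝ) 1)).mul_const (inner ℝ (f' x) v)).add
      (((hasDerivWithinAt_id t (Icc (0 : ℝ) 1)).pow 2).const_mul (L / 2 * ‖v‖ ^ 2))
    convert! h1.sub h2 using 1
    simp
    ring
  have hanti := antitoneOn_of_hasDerivWithinAt_nonpos (convex_Icc (0 : ℝ) 1)
    (fun t ht => (hderiv t ht).continuousWithinAt)
    (fun t ht => (hderiv t (interior_subset ht)).mono interior_subset) (fun t ht => by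
      have ht := interior_subset ht
      have h1 : inner ℝ (f' (x + t • v) - f' x) v ≤ L * t * ‖v‖ ^ 2 :=
        calc inner ℝ (f' (x + t • v) - f' x) v ≤ ‖f' (x + t • v) - f' x‖ * ‖v‖ :=
              real_inner_le_norm _ _
          _ ≤ L * ‖x + t • v - x‖ * ‖v‖ := by
              gcongr
              exact hL.norm_sub_le (hmaps ht) hx
          _ = L * t * ‖v‖ ^ 2 := by
              rw [add_sub_cancel_left, norm_smul, Real.norm_of_nonneg ht.1]; ring
      rw [inner_sub_left] at h1
      linarith)
  have := hanti (left_mem_Icc.2 zero_le_one) (right_mem_Icc.2 zero_le_one) zero_le_one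
  simp [hv] at this
  linarith

theorem inner_gradient_nonneg_of_isMinOn {f : F → ℝ} {a z w : F} {K C : Set F}
    (hC : Convex ℝ C) (hCK : C ⊆ K) (hz : z ∈ C) (hw : w ∈ C) (hf : HasGradientWithinAt f a K z)
    (hmin : ∀ u ∈ C, f z ≤ f u) : 0 ≤ inner ℝ a (w - z) := by
  have h := IsLocalMinOn.hasFDerivWithinAt_nonneg (IsMinOn.localize hmin)
    (hf.hasFDerivWithinAt.mono hCK)
    (sub_mem_posTangentConeAt_of_segment_subset (hC.segment_subset hz hw))
  simpa using h

end Hilbert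

/-! ### Descent directions and the subproblem. -/

namespace NOVA

variable {n m : ℕ} {P : Problem n m} {A : Approx n m} {L : ℝ≥0} {c : ℝ}

/-- Without such a direction the alternative yields Fritz John multipliers. If the one on `gradU`
vanishes, regularity kills the others too; if it is positive, dividing by it gives stationarity. -/
theorem Problem.IsRegular.exists_descent_direction {x : EuclideanSpace ℝ (Fin n)}
    (hK : Convex ℝ P.K) (hreg : P.IsRegular x) (hx : ¬ P.IsStationary x) :
    ∃ w ∈ P.K, inner ℝ (P.gradU x) (w - x) < 0 ∧
      ∀ j, P.g j x = 0 → inner ℝ (P.gradg j x) (w - x) < 0 := by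
  classical
  let a : Option {j // P.g j x = 0} → EuclideanSpace ℝ (Fin n) :=
    fun o => o.elim (P.gradU x) fun j => P.gradg j x
  rcases exists_inner_neg_or_exists_multipliers hK hreg.1.1 a with ⟨w, hw, h⟩ | ⟨l, h0, hne, hN⟩
  · exact ⟨w, hw, h none, fun j hj => h (some ⟨j, hj⟩)⟩
  exfalso
  let μ : Fin m → ℝ := fun j => if h : P.g j x = 0 then l (some ⟨j, h⟩) else 0
  have hμ0 : ∀ j, 0 ≤ μ j := fun j => by
    by_cases h : P.g j x = 0
    · simpa [μ, h] using h0 _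
    · simp [μ, h]
  have hμ : ∀ j, P.g j x ≠ 0 → μ j = 0 := fun j h => by simp [μ, h]
  have hsum : ∑ o, l o • a o = l none • P.gradU x + ∑ j, μ j • P.gradg j x := by
    rw [Fintype.sum_option]
    congr 1
    refine Fintype.sum_of_injective Subtype.val Subtype.val_injective _ _ (fun j hj => ?_)
      fun j => ?_
    · rw [hμ j (by simpa using hj), zero_smul]
    · simp [μ, a, j.2]
  rw [hsum] at hN
  rcases (h0 none).eq_or_lt with hz | hpos
  · rw [← hz, zero_smul, zero_add] at hN
    have hall := hreg.2 μ hμ0 hμ hN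
    obtain ⟨o, ho⟩ := hne
    rcases o with _ | j
    · exact ho hz.symm
    · exact ho (by simpa [μ, j.2] using hall j)
  · refine hx ⟨hreg.1, fun j => (l none)⁻¹ * μ j, fun j => mul_nonneg (inv_nonneg.2 hpos.le) (hμ0 j),
      fun j hj => by simp [hμ j hj], fun y hy => ?_⟩
    have h1 : P.gradU x + ∑ j, ((l none)⁻¹ * μ j) • P.gradg j x
        = (l none)⁻¹ • (l none • P.gradU x + ∑ j, μ j • P.gradg j x) := by
      rw [smul_add, inv_smul_smul₀ hpos.ne', Finset.smul_sum]
      simp only [mul_smul]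
    rw [h1, ← smul_neg, real_inner_smul_left]
    exact mul_nonpos_of_nonneg_of_nonpos (inv_nonneg.2 hpos.le) (hN y hy)

theorem Assumption3.convex_feasibleAt (h3 : Assumption3 P A) {y : EuclideanSpace ℝ (Fin n)}
    (hK : Convex ℝ P.K) (hy : y ∈ P.feasible) : Convex ℝ (A.feasibleAt P y) := by
  intro u hu v hv p q hp hq hpq
  refine ⟨hK hu.1 hv.1 hp hq hpq, fun j => ?_⟩
  have h : A.gt j (p • u + q • v) y ≤ p • A.gt j u y + q • A.gt j v y :=
    (h3.C1 j y hy).2 hu.1 hv.1 hp hq hpq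
  simp only [smul_eq_mul] at h
  nlinarith [mul_nonneg hp (neg_nonneg.2 (hu.2 j)), mul_nonneg hq (neg_nonneg.2 (hv.2 j))]

theorem Assumption3.feasibleAt_subset (h3 : Assumption3 P A) {y : EuclideanSpace ℝ (Fin n)}
    (hy : y ∈ P.feasible) : A.feasibleAt P y ⊆ P.feasible :=
  fun u hu => ⟨hu.1, fun j => (h3.C3 j u hu.1 y hy).trans (hu.2 j)⟩

theorem Assumption3.mem_feasibleAt_self (h3 : Assumption3 P A) {y : EuclideanSpace ℝ (Fin n)}
    (hy : y ∈ P.feasible) : y ∈ A.feasibleAt P y :=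
  ⟨hy.1, fun j => (h3.C2 j y hy).trans_le (hy.2 j)⟩

theorem IsBestResponse.inner_gradUt_nonneg {y z w : EuclideanSpace ℝ (Fin n)}
    (hz : IsBestResponse P A y z) (hK : Convex ℝ P.K) (h2 : Assumption2 P A c)
    (h3 : Assumption3 P A) (hy : y ∈ P.feasible) (hw : w ∈ A.feasibleAt P y) :
    0 ≤ inner ℝ (A.gradUt z y) (w - z) :=
  inner_gradient_nonneg_of_isMinOn (h3.convex_feasibleAt hK hy) (fun _ hu => hu.1) hz.1 hw
    (h2.hasGrad y hy z hz.1.1) hz.2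

/-- The variational inequality at `z`, tested with `y` itself, is carried over to `y` by strong
monotonicity, where the model gradient equals `gradU`. -/
theorem IsBestResponse.inner_gradU_le {y z : EuclideanSpace ℝ (Fin n)}
    (hz : IsBestResponse P A y z) (hK : Convex ℝ P.K) (h2 : Assumption2 P A c)
    (h3 : Assumption3 P A) (hy : y ∈ P.feasible) :
    inner ℝ (P.gradU y) (z - y) ≤ -(c * ‖z - y‖ ^ 2) := by
  have hv := hz.inner_gradUt_nonneg hK h2 h3 hy (h3.mem_feasibleAt_self hy)
  have hm := h2.B1 z hz.1.1 y hy.1 y hy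
  rw [h2.B2 y hy, inner_sub_right, real_inner_comm, real_inner_comm (P.gradU y)] at hm
  rw [← neg_sub z y, inner_neg_right] at hv
  linarith

/-- Near a feasible point which is not stationary the best response stays away from its base
point. -/
theorem exists_le_dist_bestResponse (hK : Convex ℝ P.K) (h2 : Assumption2 P A c)
    (h3 : Assumption3 P A) {x : EuclideanSpace ℝ (Fin n)} (hreg : P.IsRegular x)
    (hx : ¬ P.IsStationary x) :
    ∃ ε > 0, ∀ y ∈ P.feasible, dist y x < ε → ∀ z, IsBestResponse P A y z → ε ≤ dist z y := by
  obtain ⟨w, hw, hU, hg⟩ := hreg.exists_descent_direction hK hx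
  have hxX := hreg.1
  have hev : ∀ᶠ t : ℝ in 𝓝[>] 0, ∀ j, A.gt j (x + t • (w - x)) x < 0 := by
    rw [eventually_all]
    refine fun j => eventually_neg_of_hasGradientWithinAt hK hxX.1 hw (h3.hasGrad j x hxX x hxX.1)
      ((h3.C2 j x hxX).trans_le (hxX.2 j)) fun h => ?_
    rw [← h3.C5 j x hxX]
    exact hg j ((h3.C2 j x hxX).symm.trans h)
  obtain ⟨t, ht, ht0, ht1⟩ := (hev.and (Ioc_mem_nhdsGT (zero_lt_one' ℝ))).exists
  -- A fixed test point, strictly feasible for the subproblem at `x`. Strictness keeps it feasible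
  -- at nearby base points, and there it would contradict optimality of any best response close to
  -- `x`.
  set wt := x + t • (w - x) with hwt
  have hwtK : wt ∈ P.K := hK.mapsTo_line hxX.1 hw ⟨ht0.le, ht1⟩
  have hmem : (x, x) ∈ P.K ×ˢ P.feasible := ⟨hxX.1, hxX⟩
  have e1 : ∀ᶠ p in 𝓝[P.K ×ˢ P.feasible] (x, x), inner ℝ (A.gradUt p.1 p.2) (wt - p.1) < 0 := by
    have hc : ContinuousWithinAt (fun p : EuclideanSpace ℝ (Fin n) × EuclideanSpace ℝ (Fin n) =>
        inner ℝ (A.gradUt p.1 p.2) (wt - p.1)) (P.K ×ˢ P.feasible) (x, x) :=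
      ContinuousWithinAt.inner (𝕜 := ℝ) (h2.B3 _ hmem)
        (continuousWithinAt_const.sub continuous_fst.continuousWithinAt)
    refine hc.eventually_lt continuousWithinAt_const ?_
    simp only [h2.B2 x hxX, hwt, add_sub_cancel_left, real_inner_smul_right]
    exact mul_neg_of_pos_of_neg ht0 hU
  have e2 : ∀ᶠ p in 𝓝[P.K ×ˢ P.feasible] (x, x), ∀ j, A.gt j wt p.2 < 0 := by
    rw [eventually_all]
    intro j
    have hc : ContinuousWithinAt (fun p : EuclideanSpace ℝ (Fin n) × EuclideanSpace ℝ (Fin n) =>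
        A.gt j wt p.2) (P.K ×ˢ P.feasible) (x, x) := by
      have hpair : Continuous fun p : EuclideanSpace ℝ (Fin n) × EuclideanSpace ℝ (Fin n) =>
        (wt, p.2) := by fun_prop
      have h := h3.C4 j (wt, x) ⟨hwtK, hxX⟩
      exact ContinuousWithinAt.comp (x := (x, x)) (t := P.K ×ˢ P.feasible)
        (g := fun p : EuclideanSpace ℝ (Fin n) × EuclideanSpace ℝ (Fin n) => A.gt j p.1 p.2) h hpair.continuousWithinAt
        fun p hp => ⟨hwtK, hp.2⟩
    exact hc.eventually_lt continuousWithinAt_const (ht j)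
  obtain ⟨δ, hδ, hball⟩ := Metric.mem_nhdsWithin_iff.1 (e1.and e2)
  refine ⟨δ / 2, half_pos hδ, fun y hy hyx z hz => ?_⟩
  by_contra! hlt
  have hzx : dist z x < δ := (dist_triangle z y x).trans_lt (by linarith)
  obtain ⟨hneg, hfeas⟩ := hball (a := (z, y))
    ⟨by rw [Metric.mem_ball, Prod.dist_eq]; exact max_lt hzx (by dsimp only; linarith), hz.1.1, hy⟩
  exact hneg.not_ge (hz.inner_gradUt_nonneg hK h2 h3 hy ⟨hwtK, fun j => (hfeas j).le⟩)

/-! ### Compactness and decrease along the iterates. -/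

theorem Assumption1.isCompact_sublevel (h1 : Assumption1 P L) (b : ℝ) :
    IsCompact {x | x ∈ P.K ∧ P.U x ≤ b} := by
  have hcont : ContinuousOn P.U P.K := fun x hx => (h1.hasGradU x hx).continuousWithinAt
  refine Metric.isCompact_of_isClosed_isBounded
    (hcont.preimage_isClosed_of_isClosed h1.closed isClosed_Iic) ?_
  have h := h1.coercive.eventually (eventually_gt_atTop b)
  rw [eventually_inf_principal] at h
  rw [Bornology.isBounded_def]
  filter_upwards [h] with u hu hmem
  exact (hu hmem.1).not_ge hmem.2

theorem Assumption1.isClosed_feasible (h1 : Assumption1 P L) : IsClosed P.feasible := by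
  have : P.feasible = P.K ∩ ⋂ j, {x | x ∈ P.K ∧ P.g j x ≤ 0} := by
    ext; simp only [Problem.feasible, mem_ofPred_eq, mem_inter_iff, mem_iInter]; grind
  rw [this]
  refine h1.closed.inter (isClosed_iInter fun j => ?_)
  have hcont : ContinuousOn (P.g j) P.K := fun x hx => (h1.hasGradg j x hx).continuousWithinAt
  exact hcont.preimage_isClosed_of_isClosed h1.closed isClosed_Iic

theorem IsBestResponse.U_step_le {y d : EuclideanSpace ℝ (Fin n)} {γ : ℝ}
    (h1 : Assumption1 P L) (h2 : Assumption2 P A c) (h3 : Assumption3 P A) (hy : y ∈ P.feasible)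
    (hd : IsBestResponse P A y (y + d)) (h0 : 0 ≤ γ) (hγ : γ ≤ 1) :
    P.U (y + γ • d) ≤ P.U y - γ * (c - γ * L / 2) * ‖d‖ ^ 2 := by
  have hK : y + γ • d ∈ P.K := by
    simpa using h1.convex.mapsTo_line hy.1 hd.1.1 ⟨h0, hγ⟩
  have h := le_add_inner_add_of_lipschitzOnWith_gradient h1.convex h1.hasGradU h1.lipschitz hy.1 hK
  have hi := hd.inner_gradU_le h1.convex h2 h3 hy
  rw [add_sub_cancel_left, norm_smul, Real.norm_of_nonneg h0, real_inner_smul_right] at h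
  rw [add_sub_cancel_left] at hi
  nlinarith [mul_le_mul_of_nonneg_left hi h0]

theorem IsNOVASequence.mem_feasible {γ : ℕ → ℝ} {x : ℕ → EuclideanSpace ℝ (Fin n)}
    (hx : IsNOVASequence P A γ x) (hK : Convex ℝ P.K) (h3 : Assumption3 P A) (ν : ℕ) :
    x ν ∈ P.feasible := by
  induction ν with
  | zero => exact hx.init
  | succ ν ih =>
    by_cases hs : P.IsStationary (x ν)
    · rwa [hx.stopped ν hs]
    · obtain ⟨z, hz, hstep⟩ := hx.step ν hs
      rw [hstep]
      exact h3.feasibleAt_subset ih ((h3.convex_feasibleAt hK ih).mapsTo_line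
        (h3.mem_feasibleAt_self ih) hz.1 ⟨(hx.stepSize ν).1.le, (hx.stepSize ν).2⟩)

theorem IsNOVASequence.eq_of_isStationary {γ : ℕ → ℝ} {x : ℕ → EuclideanSpace ℝ (Fin n)}
    (hx : IsNOVASequence P A γ x) {N : ℕ} (hN : P.IsStationary (x N)) :
    ∀ ν ≥ N, x ν = x N := by
  intro ν hν
  induction ν, hν using Nat.le_induction with
  | base => rfl
  | succ k hk ih => rw [hx.stopped k (ih ▸ hN), ih]

/-! ### Limit points. -/

/-- The limit behaviour of the algorithm when it never stops, the step sizes are not summable and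
the decrease factors `c - γ L / 2` are eventually bounded away from zero. -/
theorem limit_behaviour_of_not_stationary (h1 : Assumption1 P L) (h2 : Assumption2 P A c)
    (h3 : Assumption3 P A) (h5 : Assumption5 P) {γ : ℕ → ℝ} {x : ℕ → EuclideanSpace ℝ (Fin n)}
    (hx : IsNOVASequence P A γ x) (hns : ∀ ν, ¬ P.IsStationary (x ν)) {η : ℝ} (hη : 0 < η)
    (hγ : ∀ᶠ ν in atTop, η ≤ c - γ ν * L / 2)
    (hsum : Tendsto (fun N => ∑ ν ∈ Finset.range N, γ ν) atTop atTop) :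
    Bornology.IsBounded (range x) ∧
      (∀ xbar, MapClusterPt xbar atTop x → P.IsStationary xbar) ∧
      ∀ xbar, MapClusterPt xbar atTop x → ¬ IsLocalMaxOn P.U P.feasible xbar := by
  have hfeas := hx.mem_feasible h1.convex h3
  have hd : ∀ ν, ∃ d, IsBestResponse P A (x ν) (x ν + d) ∧ x (ν + 1) = x ν + γ ν • d := by
    intro ν
    obtain ⟨z, hz, hs⟩ := hx.step ν (hns ν)
    exact ⟨z - x ν, by simpa using hz, hs⟩
  choose d hbr hstep using hd
  -- The escape bound applied at the iterate itself, which is regular and not stationary.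
  have hdne : ∀ ν, d ν ≠ 0 := by
    intro ν h0
    obtain ⟨ε, hε, h⟩ := exists_le_dist_bestResponse h1.convex h2 h3 (h5 _ (hfeas ν)) (hns ν)
    have := h _ (hfeas ν) (by simpa using hε) _ (hbr ν)
    simp [h0] at this
    linarith
  obtain ⟨N₀, hN₀⟩ := eventually_atTop.1 hγ
  have hdec : ∀ ν ≥ N₀, η * (γ ν * ‖d ν‖ ^ 2) ≤ P.U (x ν) - P.U (x (ν + 1)) := by
    intro ν hν
    have h := (hbr ν).U_step_le h1 h2 h3 (hfeas ν) (hx.stepSize ν).1.le (hx.stepSize ν).2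
    rw [← hstep] at h
    have h4 := mul_le_mul_of_nonneg_right (hN₀ ν hν)
      (mul_nonneg (hx.stepSize ν).1.le (sq_nonneg ‖d ν‖))
    linarith
  have hstrict : ∀ ν ≥ N₀, P.U (x (ν + 1)) < P.U (x ν) := by
    intro ν hν
    have h := hdec ν hν
    have : 0 < η * (γ ν * ‖d ν‖ ^ 2) :=
      mul_pos hη (mul_pos (hx.stepSize ν).1 (pow_pos (norm_pos_iff.2 (hdne ν)) 2))
    linarith
  have hanti : Antitone fun k => P.U (x (k + N₀)) := antitone_nat_of_succ_le fun k => by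
    have := hstrict (k + N₀) (Nat.le_add_left _ _)
    rw [add_right_comm]
    exact this.le
  have hcpt := h1.isCompact_sublevel (P.U (x N₀))
  have hsub : ∀ k, x (k + N₀) ∈ {u | u ∈ P.K ∧ P.U u ≤ P.U (x N₀)} := fun k =>
    ⟨(hfeas _).1, by simpa using hanti (Nat.zero_le k)⟩
  have hUcont : ContinuousOn P.U P.K := fun u hu => (h1.hasGradU u hu).continuousWithinAt
  have hbdd : BddBelow (range fun k => P.U (x (k + N₀))) := by
    refine (hcpt.bddBelow_image (hUcont.mono fun _ hu => hu.1)).mono ?_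
    rintro _ ⟨k, rfl⟩
    exact ⟨_, hsub k, rfl⟩
  obtain ⟨l, hl⟩ : ∃ l, Tendsto (fun k => P.U (x (k + N₀))) atTop (𝓝 l) :=
    ⟨_, tendsto_atTop_ciInf hanti hbdd⟩
  have hle : ∀ ν ≥ N₀, l ≤ P.U (x ν) := fun ν hν => by
    have := hanti.le_of_tendsto hl (ν - N₀)
    rwa [Nat.sub_add_cancel hν] at this
  have hlim : Tendsto (fun ν => P.U (x ν)) atTop (𝓝 l) := (tendsto_add_atTop_iff_nat N₀).1 hl
  have hclosed : ∀ xbar, MapClusterPt xbar atTop x → xbar ∈ P.feasible := fun xbar hxb =>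
    h1.isClosed_feasible.closure_subset (mem_closure_iff_nhds.2 fun s hs =>
      let ⟨ν, hν⟩ := (mapClusterPt_iff_frequently.1 hxb s hs).exists
      ⟨x ν, hν, hfeas ν⟩)
  refine ⟨?_, fun xbar hxb => ?_, fun xbar hxb hmax => ?_⟩
  · have : range x ⊆ x '' (Iio N₀) ∪ {u | u ∈ P.K ∧ P.U u ≤ P.U (x N₀)} := by
      rintro _ ⟨ν, rfl⟩
      rcases lt_or_ge ν N₀ with h | h
      · exact Or.inl ⟨ν, h, rfl⟩
      · right
        have := hsub (ν - N₀)
        rwa [Nat.sub_add_cancel h] at this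
    exact (((finite_Iio N₀).image x).isBounded.union hcpt.isBounded).subset this
  · by_contra hst
    obtain ⟨ε, hε, hesc⟩ := exists_le_dist_bestResponse h1.convex h2 h3
      (h5 _ (hclosed xbar hxb)) hst
    have hdε : ∀ ν, dist (x ν) xbar < ε → ε ≤ ‖d ν‖ := fun ν hν => by
      simpa using hesc _ (hfeas ν) hν _ (hbr ν)
    -- The tolerance is `η * ε` times the allowed path length `ε / 2`; starting within `ε / 2` of
    -- `xbar`, the path then stays in the `ε`-ball.
    have hev : ∀ᶠ ν in atTop, N₀ ≤ ν ∧ P.U (x ν) < l + η * (ε * (ε / 2)) :=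
      (eventually_ge_atTop N₀).and (hlim.eventually (gt_mem_nhds (by
        have : 0 < η * (ε * (ε / 2)) := by positivity
        linarith)))
    obtain ⟨a, haball, haN, haU⟩ := ((mapClusterPt_iff_frequently.1 hxb _
      (Metric.ball_mem_nhds xbar (half_pos hε))).and_eventually hev).exists
    rw [Metric.mem_ball] at haball
    -- as long as the iterates stay near `xbar`, the decrease of `U` controls the path length
    have hpath : ∀ b, a ≤ b → (∀ k, a ≤ k → k < b → dist (x k) xbar < ε) →
        ∑ k ∈ Finset.Ico a b, γ k * ‖d k‖ < ε / 2 ∧ ∑ k ∈ Finset.Ico a b, γ k * ε < ε / 2 := by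
      intro b hab hb
      have hk : ∀ k ∈ Finset.Ico a b, ε ≤ ‖d k‖ ∧ N₀ ≤ k := fun k hk => by
        rw [Finset.mem_Ico] at hk
        exact ⟨hdε k (hb k hk.1 hk.2), haN.trans hk.1⟩
      have htel : ∑ k ∈ Finset.Ico a b, η * ε * (γ k * ‖d k‖) ≤ P.U (x a) - P.U (x b) := by
        have h := Finset.sum_Ico_sub (fun k => -P.U (x k)) hab
        have h' : P.U (x a) - P.U (x b) = ∑ k ∈ Finset.Ico a b,
            (-P.U (x (k + 1)) - -P.U (x k)) := by rw [h]; ring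
        rw [h']
        refine Finset.sum_le_sum fun k hkm => ?_
        have h4 := hdec k (hk k hkm).2
        have h6 : η * ε * (γ k * ‖d k‖) ≤ η * (γ k * ‖d k‖ ^ 2) := by
          have := mul_le_mul_of_nonneg_left (hk k hkm).1
            (mul_nonneg hη.le (mul_nonneg (hx.stepSize k).1.le (norm_nonneg (d k))))
          linarith
        linarith
      rw [← Finset.mul_sum] at htel
      have hlt : ∑ k ∈ Finset.Ico a b, γ k * ‖d k‖ < ε / 2 := by
        have := hle b (haN.trans hab)
        refine lt_of_mul_lt_mul_left (a := η * ε) ?_ (by positivity)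
        linarith
      refine ⟨hlt, (Finset.sum_le_sum fun k hkm => ?_).trans_lt hlt⟩
      exact mul_le_mul_of_nonneg_left (hk k hkm).1 (hx.stepSize k).1.le
    -- The path bound up to `b` only needs closeness at indices below `b`, so strong induction
    -- closes the loop.
    have hstay : ∀ b, a ≤ b → dist (x b) xbar < ε := by
      intro b
      induction b using Nat.strong_induction_on with
      | _ b ih =>
        intro hab
        have hp := (hpath b hab fun k hk hkb => ih k hkb hk).1
        have hdist : dist (x a) (x b) ≤ ∑ k ∈ Finset.Ico a b, γ k * ‖d k‖ :=
          dist_le_Ico_sum_of_dist_le hab fun {k} _ _ => by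
            rw [hstep k, dist_self_add_right, norm_smul,
              Real.norm_of_nonneg (hx.stepSize k).1.le]
        have := dist_triangle_left (x b) xbar (x a)
        linarith
    -- Divergence makes the step sizes from `a` to `b` sum to at least `1`, contradicting the bound
    -- `∑ γ k * ε < ε / 2`.
    obtain ⟨b, hbs, hab⟩ := ((hsum.eventually_ge_atTop
      (1 + ∑ k ∈ Finset.range a, γ k)).and (eventually_ge_atTop a)).exists
    have h := (hpath b hab fun k hk _ => hstay k hk).2
    rw [← Finset.sum_mul, Finset.sum_Ico_eq_sub _ hab] at h
    nlinarith
  · have hxbX := hclosed xbar hxb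
    have hUx : P.U xbar = l := by
      -- `U` is continuous only relative to `K`, so the limit is taken along a filter that also
      -- lives on the feasible set.
      have hcl : ClusterPt xbar (map x atTop ⊓ 𝓟 P.feasible) := by
        have : map x atTop ≤ 𝓟 P.feasible := le_principal_iff.2 (mem_map.2 (univ_mem' hfeas))
        rwa [inf_eq_left.2 this]
      have hne : (𝓝 xbar ⊓ (map x atTop ⊓ 𝓟 P.feasible)).NeBot := hcl
      have t1 : Tendsto P.U (𝓝 xbar ⊓ (map x atTop ⊓ 𝓟 P.feasible)) (𝓝 (P.U xbar)) :=
        ((hUcont xbar hxbX.1).mono fun _ hu => hu.1).mono_left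
          (inf_le_inf_left _ inf_le_right)
      have t2 : Tendsto P.U (𝓝 xbar ⊓ (map x atTop ⊓ 𝓟 P.feasible)) (𝓝 l) :=
        Tendsto.mono_left (tendsto_map'_iff.2 hlim) (inf_le_right.trans inf_le_left)
      exact tendsto_nhds_unique t1 t2
    -- Iterates arbitrarily near `xbar` have values strictly above `l = U xbar`, since `U` still
    -- decreases strictly towards `l`.
    obtain ⟨s, hs, hsmax⟩ := mem_nhdsWithin_iff_exists_mem_nhds_inter.1 hmax
    obtain ⟨ν, hνs, hν⟩ := ((mapClusterPt_iff_frequently.1 hxb _ hs).and_eventually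
      (eventually_ge_atTop N₀)).exists
    have h6 : P.U (x ν) ≤ P.U xbar := hsmax ⟨hνs, hfeas ν⟩
    have h7 := hle (ν + 1) (hν.trans (Nat.le_succ ν))
    have h8 := hstrict ν hν
    linarith

theorem limit_behaviour (h1 : Assumption1 P L) (h2 : Assumption2 P A c)
    (h3 : Assumption3 P A) (h5 : Assumption5 P) {γ : ℕ → ℝ} {x : ℕ → EuclideanSpace ℝ (Fin n)}
    (hx : IsNOVASequence P A γ x) {η : ℝ} (hη : 0 < η)
    (hγ : ∀ᶠ ν in atTop, η ≤ c - γ ν * L / 2)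
    (hsum : Tendsto (fun N => ∑ ν ∈ Finset.range N, γ ν) atTop atTop) :
    Bornology.IsBounded (range x) ∧
      (∀ xbar, MapClusterPt xbar atTop x → P.IsStationary xbar) ∧
      ((∀ ν, ¬ P.IsStationary (x ν)) →
        ∀ xbar, MapClusterPt xbar atTop x → ¬ IsLocalMaxOn P.U P.feasible xbar) := by
  by_cases hns : ∀ ν, ¬ P.IsStationary (x ν)
  · obtain ⟨hb, hs, hm⟩ := limit_behaviour_of_not_stationary h1 h2 h3 h5 hx hns hη hγ hsum
    exact ⟨hb, hs, fun _ => hm⟩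
  · refine ⟨?_, ?_, fun h => absurd h hns⟩
    all_goals
      push Not at hns
      obtain ⟨N, hN⟩ := hns
      have hlim : Tendsto x atTop (𝓝 (x N)) := tendsto_const_nhds.congr'
        (eventually_atTop.2 ⟨N, fun ν hν => (hx.eq_of_isStationary hN ν hν).symm⟩)
    · exact Metric.isBounded_range_of_tendsto x hlim
    · intro xbar hxb
      have hne : (𝓝 xbar ⊓ 𝓝 (x N)).NeBot :=
        NeBot.mono (show (𝓝 xbar ⊓ map x atTop).NeBot from hxb) (inf_le_inf_left _ hlim)
      rwa [eq_of_nhds_neBot hne]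

end NOVA

/-! ### The two step-size rules. -/

theorem theorem1 {n m : ℕ} (P : NOVA.Problem n m) (A : NOVA.Approx n m) (L : ℝ≥0) (c : ℝ)
    (h1 : NOVA.Assumption1 P L) (h2 : NOVA.Assumption2 P A c) (h3 : NOVA.Assumption3 P A)
    (h5 : NOVA.Assumption5 P)
    (γ : ℕ → ℝ) (x : ℕ → EuclideanSpace ℝ (Fin n)) (hx : NOVA.IsNOVASequence P A γ x) :
    -- (a) iterate feasibility
    (∀ ν, x ν ∈ A.feasibleAt P (x ν) ∧ A.feasibleAt P (x ν) ⊆ P.feasible) ∧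
    -- (b) step sizes bounded away from zero
    (∀ γmax : ℝ, 0 < (⨅ ν, γ ν) → (⨆ ν, γ ν) ≤ γmax → γmax ≤ 1 → γmax * L < 2 * c →
      Bornology.IsBounded (range x) ∧
      (∀ xbar, MapClusterPt xbar atTop x → P.IsStationary xbar) ∧
      ((∀ ν, ¬ P.IsStationary (x ν)) →
        ∀ xbar, MapClusterPt xbar atTop x → ¬ IsLocalMaxOn P.U P.feasible xbar)) ∧
    -- (c) diminishing step sizes
    (Tendsto γ atTop (𝓝 0) → Tendsto (fun N => ∑ ν ∈ Finset.range N, γ ν) atTop atTop →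
      Bornology.IsBounded (range x) ∧
      (∃ xbar, MapClusterPt xbar atTop x ∧ P.IsStationary xbar) ∧
      (NOVA.Assumption4 P A → IsCompact P.feasible →
        ∀ xbar, MapClusterPt xbar atTop x → P.IsStationary xbar) ∧
      ((∀ ν, ¬ P.IsStationary (x ν)) →
        ∀ xbar, MapClusterPt xbar atTop x → ¬ IsLocalMaxOn P.U P.feasible xbar)) := by
  have hfeas := hx.mem_feasible h1.convex h3
  refine ⟨fun ν => ⟨h3.mem_feasibleAt_self (hfeas ν), h3.feasibleAt_subset (hfeas ν)⟩, ?_, ?_⟩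
  · intro γmax hinf hsup _ hc
    have hbelow : BddBelow (range γ) := ⟨0, by rintro _ ⟨ν, rfl⟩; exact (hx.stepSize ν).1.le⟩
    have habove : BddAbove (range γ) := ⟨1, by rintro _ ⟨ν, rfl⟩; exact (hx.stepSize ν).2⟩
    refine NOVA.limit_behaviour h1 h2 h3 h5 hx (η := c - γmax * L / 2) (by linarith)
      (Eventually.of_forall fun ν => ?_) ?_
    · have := mul_le_mul_of_nonneg_right ((le_ciSup habove ν).trans hsup) L.coe_nonneg
      linarith
    -- The partial sums dominate `N * ⨅ ν, γ ν`.
    · refine tendsto_atTop_mono (fun N => ?_)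
        (tendsto_natCast_atTop_atTop.atTop_mul_const hinf)
      simpa using Finset.card_nsmul_le_sum (Finset.range N) γ (⨅ ν, γ ν)
        fun ν _ => ciInf_le hbelow ν
  · intro hγ hsum
    have hlim : Tendsto (fun ν => c - γ ν * L / 2) atTop (𝓝 c) := by
      simpa using tendsto_const_nhds.sub ((hγ.mul_const (L : ℝ)).div_const 2)
    -- Here `η = c / 2`: the factors `c - γ ν * L / 2` tend to `c > 0`.
    obtain ⟨hb, hs, hm⟩ := NOVA.limit_behaviour h1 h2 h3 h5 hx (half_pos h2.c_pos)
      (hlim.eventually (le_mem_nhds (half_lt_self h2.c_pos))) hsum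
    refine ⟨hb, ?_, fun _ _ => hs, hm⟩
    obtain ⟨xbar, -, hxb⟩ := hb.isCompact_closure.exists_mapClusterPt (f := atTop) (u := x)
      (le_principal_iff.2 (mem_map.2 (univ_mem' fun ν => subset_closure (mem_range_self ν))))
    exact ⟨xbar, hxb, hs xbar hxb⟩
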